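/- Let $V$ be a nonzero finite-dimensional real vector space and let $C\subseteq V$ be a proper polyhedral cone, i.e. a convex cone that is closed, salient ($C\cap(-C)=\{0\}$), generating (its linear span is $V$) and the conical hull of a finite set. Let $n\ge 2$ be an integer and let $\mathrm{PSD}_n$ be the cone of positive semidefinite matrices in the real vector space of complex Hermitian $n\times n$ matrices. For convex cones $C_1\subseteq V_1$ and $C_2\subseteq V_2$ in finite-dimensional real vector spaces put $$C_1\otimes_{\min}C_2=\operatorname{conv}\{x_1\otimes x_2: x_1\in C_1,\ x_2\in C_2\},$$ $$C_1\otimes_{\max}C_2=\{z\in V_1\otimes V_2: (f_1\otimes f_2)(z)\ge 0\ \text{ for all } f_1\in C_1^*,\ f_2\in C_2^*\},$$ where $C_i^*\subseteq V_i^*$ is the cone of linear functionals that are nonnegative on $C_i$. The pair $(C_1,C_2)$ is called nuclear if $C_1\otimes_{\min}C_2=C_1\otimes_{\max}C_2$, and a cone is called classical if some linear bijection of its ambient space onto $\mathbb{R}^m$, for some $m\ge 1$, maps it onto $\mathbb{R}_+^m$. Then the pair $(C,\mathrm{PSD}_n)$ is nuclear if and only if $C$ is classical. -/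

import Mathlib

open scoped TensorProduct ComplexOrder

namespace ConeTensor

/-- Two convex cones are isomorphic if some linear bijection of the ambient spaces maps the first
onto the second. -/
def Isomorphic {V W : Type*} [AddCommGroup V] [Module ℝ V] [AddCommGroup W] [Module ℝ W]
    (C : PointedCone ℝ V) (D : PointedCone ℝ W) : Prop :=
  ∃ Φ : V ≃ₗ[ℝ] W, Φ '' (C : Set V) = (D : Set W)

/-- A convex cone is proper if it is closed, salient (`C ∩ -C = {0}`) and generating (its linear
span is the whole space). -/
structure IsProper {V : Type*} [AddCommGroup V] [Module ℝ V] [TopologicalSpace V]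
    (C : PointedCone ℝ V) : Prop where
  isClosed : IsClosed (C : Set V)
  salient : ∀ x : V, x ∈ C → -x ∈ C → x = 0
  generating : Submodule.span ℝ (C : Set V) = ⊤

/-- A convex cone is polyhedral if it is the conical hull of a finite set. -/
def IsPolyhedral {V : Type*} [AddCommGroup V] [Module ℝ V] (C : PointedCone ℝ V) : Prop :=
  ∃ s : Set V, s.Finite ∧ PointedCone.hull ℝ s = C

/-- A convex cone is classical if it is isomorphic to the nonnegative orthant of `ℝᵐ` for some
`m ≥ 1`. -/
def IsClassical {V : Type*} [AddCommGroup V] [Module ℝ V] (C : PointedCone ℝ V) : Prop :=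
  ∃ m : ℕ, 1 ≤ m ∧ Isomorphic C (PointedCone.positive ℝ (Fin m → ℝ))

/-- A pair of convex cones is nuclear if its minimal and maximal tensor products coincide. -/
def IsNuclear {V W : Type*} [AddCommGroup V] [Module ℝ V] [AddCommGroup W] [Module ℝ W]
    (C : PointedCone ℝ V) (D : PointedCone ℝ W) : Prop :=
  PointedCone.minTensorProduct C D = PointedCone.maxTensorProduct C D

/-- The real vector space of complex Hermitian `n × n` matrices. -/
abbrev Herm (n : ℕ) : Type := selfAdjoint (Matrix (Fin n) (Fin n) ℂ)

/-- The cone of positive semidefinite matrices in the real vector space of complex Hermitian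
`n × n` matrices. -/
def PSD (n : ℕ) : PointedCone ℝ (Herm n) where
  carrier := {A | (A : Matrix (Fin n) (Fin n) ℂ).PosSemidef}
  add_mem' := fun hA hB => by simpa using hA.add hB
  zero_mem' := by simpa using Matrix.PosSemidef.zero
  smul_mem' := fun c A hA => hA.smul c.2

end ConeTensor

/-! Nuclearity forces a rigid face structure: any `t` in the face generated by `a + c` lies in the
span of the generators in the faces of `a` and of `c` (`mem_span_of_isNuclear`). Otherwise some `r`
kills those generators but not `t`. Take `g`, `h` vanishing at `a`, `c` respectively and dominating
`|r|` on the other generators. Then `[[g, r], [r, h]]` is nonnegative on the minimal product, while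
`blockTensor` lies in the maximal one and has pairing `-2ε r(t) + O(ε²)`, negative for a suitable
small `ε`.

For irredundant generators of a salient cone, induction turns this into: a set of generators
contains every generator in its face (`mem_of_inFace_sum`). A linear relation would put a generator
in the face of others, so the cone is simplicial. Conversely, over a simplicial cone the maximal
product is tested coefficientwise, and `PSD n` is closed. -/

namespace ConeTensor

/-! ### Farkas' lemma and exposed faces -/

/-- **Farkas' lemma** for finitely generated cones. -/
theorem mem_hull_image_of_forall_dual {ι V : Type*} [DecidableEq ι] [AddCommGroup V] [Module ℝ V]
    (s : Finset ι) : ∀ (e : ι → V) (v : V),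
      (∀ f : Module.Dual ℝ V, (∀ i ∈ s, 0 ≤ f (e i)) → 0 ≤ f v) →
      v ∈ PointedCone.hull ℝ (e '' s) := by
  induction s using Finset.induction_on with
  | empty =>
    intro e v h
    have : v = 0 := (Module.forall_dual_apply_eq_zero_iff ℝ v).1 fun f =>
      le_antisymm (by simpa using h (-f) (by simp)) (h f (by simp))
    simp [this]
  | insert j s hj ih =>
    intro e v h
    by_cases hc : ∀ f : Module.Dual ℝ V, (∀ i ∈ s, 0 ≤ f (e i)) → 0 ≤ f v
    · exact Submodule.span_mono (Set.image_mono (by simp)) (ih e v hc)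
    push Not at hc
    obtain ⟨f, hf, hfv⟩ := hc
    have hfj : f (e j) < 0 := by
      by_contra! hcon
      exact absurd (h f (by simpa [hcon] using hf)) (not_le.2 hfv)
    -- Project along `e j` onto the kernel of `f`. By the signs of `f`, projecting a generator and
    -- lifting `v` back both add nonnegative multiples of `e j`.
    have key := ih (fun i => e i - (f (e i) / f (e j)) • e j) (v - (f v / f (e j)) • e j) ?_
    · have hsub : PointedCone.hull ℝ ((fun i => e i - (f (e i) / f (e j)) • e j) '' (s : Set ι)) ≤
          PointedCone.hull ℝ (e '' ((insert j s : Finset ι) : Set ι)) := by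
        refine Submodule.span_le.2 ?_
        rintro _ ⟨i, hi, rfl⟩
        have h1 : e i ∈ PointedCone.hull ℝ (e '' ((insert j s : Finset ι) : Set ι)) :=
          Submodule.subset_span ⟨i, by simp_all, rfl⟩
        have h2 : e j ∈ PointedCone.hull ℝ (e '' ((insert j s : Finset ι) : Set ι)) :=
          Submodule.subset_span ⟨j, by simp, rfl⟩
        have h3 : 0 ≤ -(f (e i) / f (e j)) :=
          neg_nonneg.2 (div_nonpos_of_nonneg_of_nonpos (hf i hi) hfj.le)
        simpa [sub_eq_add_neg] using add_mem h1 (PointedCone.smul_mem _ h3 h2)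
      have h2 : e j ∈ PointedCone.hull ℝ (e '' ((insert j s : Finset ι) : Set ι)) :=
        Submodule.subset_span ⟨j, by simp, rfl⟩
      have h3 : 0 ≤ f v / f (e j) := (div_pos_of_neg_of_neg hfv hfj).le
      simpa using add_mem (hsub key) (PointedCone.smul_mem _ h3 h2)
    · intro φ hφ
      have := h (φ - (φ (e j) / f (e j)) • f) ?_
      · simp only [LinearMap.sub_apply, LinearMap.smul_apply, smul_eq_mul, map_sub, map_smul]
          at this ⊢
        convert this using 2
        ring
      · intro i hi
        rcases Finset.mem_insert.1 hi with rfl | hi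
        · simp [hfj.ne]
        · have := hφ i hi
          simp only [LinearMap.sub_apply, LinearMap.smul_apply, smul_eq_mul, map_sub, map_smul]
            at this ⊢
          convert this using 2
          ring

theorem mem_hull_of_forall_dual {V : Type*} [AddCommGroup V] [Module ℝ V] {s : Set V}
    (hs : s.Finite) {v : V}
    (h : ∀ f : Module.Dual ℝ V, (∀ e ∈ s, 0 ≤ f e) → 0 ≤ f v) :
    v ∈ PointedCone.hull ℝ s := by
  classical
  lift s to Finset V using hs
  simpa using mem_hull_image_of_forall_dual s id v (by simpa using h)

/-- `x` lies below a nonnegative multiple of `a` in the order defined by `C`; for `x ∈ C` and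
`a ∈ C` this says that `x` lies in the smallest face of `C` containing `a`. -/
def InFace {V : Type*} [AddCommGroup V] [Module ℝ V] (C : PointedCone ℝ V) (a x : V) : Prop :=
  ∃ M : ℝ, 0 ≤ M ∧ M • a - x ∈ C

section

variable {V : Type*} [AddCommGroup V] [Module ℝ V]

theorem nonneg_of_mem_hull {s : Set V} {f : Module.Dual ℝ V} (hf : ∀ e ∈ s, 0 ≤ f e) {x : V}
    (hx : x ∈ PointedCone.hull ℝ s) : 0 ≤ f x := by
  have : f ∈ PointedCone.dual (Module.Dual.eval ℝ V) (PointedCone.hull ℝ s : Set V) := by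
    rw [PointedCone.dual_hull]
    exact fun e he => hf e he
  exact this hx

/-- Farkas with `-a` adjoined to the generators: if `-e` were in the enlarged cone, some `c • a - e`
with `0 ≤ c` would lie in the original one. -/
theorem exists_pos_of_not_inFace {s : Set V} (hs : s.Finite) {a : V}
    (ha : a ∈ PointedCone.hull ℝ s) {e : V} (he : ¬ InFace (PointedCone.hull ℝ s) a e) :
    ∃ f : Module.Dual ℝ V, (∀ x ∈ s, 0 ≤ f x) ∧ f a = 0 ∧ 0 < f e := by
  have hne : -e ∉ PointedCone.hull ℝ (insert (-a) s) := by
    intro hmem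
    obtain ⟨c, z, hz, hcz⟩ := Submodule.mem_span_insert.1 hmem
    refine he ⟨c, c.2, ?_⟩
    have : (c : ℝ) • a - e = z := by
      rw [sub_eq_add_neg, hcz, Nonneg.mk_smul]
      simp
    rwa [this]
  have := mt (mem_hull_of_forall_dual (hs.insert (-a))) hne
  push Not at this
  obtain ⟨f, hf, hfe⟩ := this
  have hfs : ∀ x ∈ s, 0 ≤ f x := fun x hx => hf x (Set.mem_insert_of_mem _ hx)
  refine ⟨f, hfs, le_antisymm (by simpa using hf (-a) (Set.mem_insert _ _))
    (nonneg_of_mem_hull hfs ha), by simpa using hfe⟩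

/-- A face of a finitely generated cone is exposed by a functional that is as large as desired on
the generators outside of the face. -/
theorem exists_exposing {s : Set V} (hs : s.Finite) {a : V} (ha : a ∈ PointedCone.hull ℝ s)
    (β : V → ℝ) :
    ∃ g : Module.Dual ℝ V, (∀ x ∈ s, 0 ≤ g x) ∧ g a = 0 ∧
      ∀ e ∈ s, ¬ InFace (PointedCone.hull ℝ s) a e → β e ≤ g e := by
  classical
  have h1 : ∀ e : V, ∃ f : Module.Dual ℝ V, (∀ x ∈ s, 0 ≤ f x) ∧ f a = 0 ∧
      (¬ InFace (PointedCone.hull ℝ s) a e → β e ≤ f e) := by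
    intro e
    by_cases he : InFace (PointedCone.hull ℝ s) a e
    · exact ⟨0, by simp, by simp, fun h => absurd he h⟩
    · obtain ⟨f, hf, hfa, hfe⟩ := exists_pos_of_not_inFace hs ha he
      refine ⟨(|β e| / f e) • f, fun x hx => ?_, by simp [hfa], fun _ => ?_⟩
      · exact mul_nonneg (by positivity) (hf x hx)
      · simpa [hfe.ne'] using le_abs_self (β e)
  choose f hf hfa hfe using h1
  refine ⟨∑ e ∈ hs.toFinset, f e, fun x hx => ?_, ?_, fun e he hne => ?_⟩
  · rw [LinearMap.sum_apply]
    exact Finset.sum_nonneg fun e _ => hf e x hx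
  · simp [hfa]
  · rw [LinearMap.sum_apply]
    exact (hfe e hne).trans (Finset.single_le_sum (f := fun i => f i e)
      (fun i _ => hf i e he) (by simpa using he))

end

/-! ### Two-by-two inequalities for Hermitian matrices -/

section

variable {n : ℕ}

/-- The real part of a matrix entry as a linear functional on the Hermitian matrices. -/
noncomputable def entryRe (i j : Fin n) : Module.Dual ℝ (Herm n) where
  toFun A := ((A : Matrix (Fin n) (Fin n) ℂ) i j).re
  map_add' A B := by simp
  map_smul' c A := by simp

@[simp]
theorem entryRe_apply (i j : Fin n) (A : Herm n) :
    entryRe i j A = ((A : Matrix (Fin n) (Fin n) ℂ) i j).re := rfl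

theorem mem_PSD {A : Herm n} : A ∈ PSD n ↔ (A : Matrix (Fin n) (Fin n) ℂ).PosSemidef := Iff.rfl

theorem entryRe_diag_nonneg {A : Herm n} (hA : A ∈ PSD n) (i : Fin n) : 0 ≤ entryRe i i A :=
  (Complex.nonneg_iff.1 (mem_PSD.1 hA).diag_nonneg).1

/-- The principal minor on `i, j` is nonnegative; the squared imaginary part is dropped. -/
theorem entryRe_sq_le {A : Herm n} (hA : A ∈ PSD n) (i j : Fin n) :
    entryRe i j A ^ 2 ≤ entryRe i i A * entryRe j j A := by
  have hP := mem_PSD.1 hA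
  have hi := (Complex.nonneg_iff.1 (hP.diag_nonneg (i := i))).2
  have hdet := (Complex.nonneg_iff.1 (hP.submatrix ![i, j]).det_nonneg).1
  have hji := congrArg Complex.re (hP.isHermitian.apply i j)
  have hji' := congrArg Complex.im (hP.isHermitian.apply i j)
  simp only [Matrix.det_fin_two, Matrix.submatrix_apply, Matrix.cons_val_zero, Matrix.cons_val_one,
    Complex.sub_re, Complex.mul_re, RCLike.star_def, Complex.conj_re, Complex.conj_im,
    entryRe_apply] at *
  rw [← hi, hji, ← hji'] at hdet
  nlinarith [sq_nonneg ((A : Matrix (Fin n) (Fin n) ℂ) j i).im]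

/-- The rank one positive semidefinite matrix attached to a vector. -/
noncomputable def outer (v : Fin n → ℂ) : Herm n :=
  ⟨Matrix.vecMulVec v (star v), (Matrix.posSemidef_vecMulVec_self_star v).isHermitian⟩

theorem outer_mem_PSD (v : Fin n → ℂ) : outer v ∈ PSD n :=
  Matrix.posSemidef_vecMulVec_self_star v

/-- The symmetric matrix with two off-diagonal entries equal to one. -/
noncomputable def offDiag (i j : Fin n) : Herm n :=
  outer (Pi.single i 1 + Pi.single j 1) - outer (Pi.single i 1) - outer (Pi.single j 1)

theorem smul_outer_add_offDiag_mem_PSD (i j : Fin n) (x y : ℝ) :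
    x ^ 2 • outer (Pi.single i 1) + (x * y) • offDiag i j + y ^ 2 • outer (Pi.single j 1) ∈
      PSD n := by
  convert outer_mem_PSD (Pi.single i (x : ℂ) + Pi.single j (y : ℂ)) using 1
  have hsmul : ∀ (k : Fin n) (w : ℝ), (Pi.single k (w : ℂ) : Fin n → ℂ) = w • Pi.single k 1 :=
    fun k w => by rw [← Pi.single_smul]; simp
  rw [hsmul, hsmul]
  refine Subtype.ext (Matrix.ext fun k l => ?_)
  simp only [offDiag, outer, Matrix.vecMulVec_apply, AddSubgroup.coe_add, AddSubgroup.coe_sub,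
    selfAdjoint.val_smul, Matrix.add_apply, Matrix.sub_apply, Matrix.smul_apply, Pi.add_apply,
    Pi.smul_apply, Pi.star_apply, star_add, star_smul, Complex.real_smul, star_trivial]
  push_cast
  ring

theorem dual_offDiag_sq_le {ψ : Module.Dual ℝ (Herm n)} (hψ : ∀ A ∈ PSD n, 0 ≤ ψ A) (i j : Fin n) :
    ψ (offDiag i j) ^ 2 ≤ 4 * (ψ (outer (Pi.single i 1)) * ψ (outer (Pi.single j 1))) := by
  have h : ∀ x : ℝ, 0 ≤ ψ (outer (Pi.single i 1)) * (x * x) + ψ (offDiag i j) * x +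
      ψ (outer (Pi.single j 1)) := by
    intro x
    have := hψ _ (smul_outer_add_offDiag_mem_PSD i j x 1)
    simp only [map_add, map_smul, smul_eq_mul] at this
    linarith
  have := discrim_le_zero h
  simp only [discrim] at this
  linarith

/-- If `q² ≤ p s` and `b² ≤ 4 a c` then the pairing of the associated positive semidefinite
matrices is nonnegative. -/
theorem pairing_nonneg {p q s a b c : ℝ} (hp : 0 ≤ p) (hs : 0 ≤ s) (ha : 0 ≤ a) (hc : 0 ≤ c)
    (hq : q ^ 2 ≤ p * s) (hb : b ^ 2 ≤ 4 * (a * c)) : 0 ≤ p * a + q * b + s * c := by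
  have h1 : (q * b) ^ 2 ≤ (p * a + s * c) ^ 2 := by
    calc (q * b) ^ 2 = q ^ 2 * b ^ 2 := by ring
      _ ≤ (p * s) * (4 * (a * c)) := by gcongr
      _ ≤ (p * a + s * c) ^ 2 := by nlinarith [sq_nonneg (p * a - s * c)]
  have h2 : 0 ≤ p * a + s * c := by positivity
  linarith [neg_le_of_abs_le (abs_le_of_sq_le_sq h1 h2)]

end

/-! ### The separating functional and the block tensor -/

section

variable {V : Type*} [AddCommGroup V] [Module ℝ V]

/-- The tensor with diagonal blocks `a + ε² M² (a + c)`, `c + ε² M² (a + c)` and off-diagonal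
block `-ε t`. -/
noncomputable def blockTensor {n : ℕ} (i j : Fin n) (a c t : V) (M ε : ℝ) : V ⊗[ℝ] Herm n :=
  (a + (ε ^ 2 * M ^ 2) • (a + c)) ⊗ₜ outer (Pi.single i 1) + ((-ε) • t) ⊗ₜ offDiag i j +
    (c + (ε ^ 2 * M ^ 2) • (a + c)) ⊗ₜ outer (Pi.single j 1)

theorem blockTensor_mem_maxTensorProduct {n : ℕ} (i j : Fin n) {C : PointedCone ℝ V} {a c t : V}
    {M : ℝ} (ha : a ∈ C) (hc : c ∈ C) (ht : t ∈ C) (hM : M • (a + c) - t ∈ C)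
    (ε : ℝ) : blockTensor i j a c t M ε ∈ PointedCone.maxTensorProduct C (PSD n) := by
  rw [PointedCone.mem_maxTensorProduct]
  intro φ hφ ψ hψ
  have h1 : 0 ≤ φ a := hφ ha
  have h2 : 0 ≤ φ c := hφ hc
  have h3 : 0 ≤ φ t := hφ ht
  have h4 : 0 ≤ φ (M • (a + c) - t) := hφ hM
  have h5 : 0 ≤ ψ (outer (Pi.single i 1)) := hψ (outer_mem_PSD _)
  have h6 : 0 ≤ ψ (outer (Pi.single j 1)) := hψ (outer_mem_PSD _)
  have h7 := dual_offDiag_sq_le (fun A hA => hψ hA) i j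
  simp only [map_sub, map_smul, map_add, smul_eq_mul] at h4
  simp only [blockTensor, map_add, TensorProduct.dualDistrib_apply, map_smul, smul_eq_mul]
  refine pairing_nonneg (by positivity) (by positivity) h5 h6 ?_ h7
  calc (-ε * φ t) ^ 2 = ε ^ 2 * φ t ^ 2 := by ring
    _ ≤ ε ^ 2 * (M * (φ a + φ c)) ^ 2 := by gcongr; linarith
    -- With `δ = ε² M² (φ a + φ c)`, the product is `φ a φ c + δ (φ a + φ c) + δ²`, and the middle
    -- term is the left side.
    _ ≤ (φ a + ε ^ 2 * M ^ 2 * (φ a + φ c)) * (φ c + ε ^ 2 * M ^ 2 * (φ a + φ c)) := by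
      have h8 : 0 ≤ φ a * φ c := by positivity
      have h9 : 0 ≤ (ε ^ 2 * M ^ 2 * (φ a + φ c)) ^ 2 := by positivity
      nlinarith

/-- At each generator the matrix `[[g, r], [r, h]]` is positive semidefinite, so its pairing with a
positive semidefinite `A` is nonnegative. -/
theorem dualDistrib_nonneg_of_mem_minTensorProduct {n : ℕ} (i j : Fin n) {s : Set V}
    {g h r : Module.Dual ℝ V} (hg : ∀ e ∈ s, 0 ≤ g e) (hh : ∀ e ∈ s, 0 ≤ h e)
    (hr : ∀ e ∈ s, |r e| ≤ g e ∧ |r e| ≤ h e ∨ r e = 0) {z : V ⊗[ℝ] Herm n}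
    (hz : z ∈ PointedCone.minTensorProduct (PointedCone.hull ℝ s) (PSD n)) :
    0 ≤ TensorProduct.dualDistrib ℝ V (Herm n)
      (g ⊗ₜ entryRe i i + (2 : ℝ) • r ⊗ₜ entryRe i j + h ⊗ₜ entryRe j j) z := by
  refine nonneg_of_mem_hull ?_ hz
  rintro _ ⟨x, hx, A, hA, rfl⟩
  have hA1 := entryRe_diag_nonneg hA i
  have hA2 := entryRe_diag_nonneg hA j
  have hA3 := entryRe_sq_le hA i j
  have hlin : TensorProduct.dualDistrib ℝ V (Herm n)
      (g ⊗ₜ entryRe i i + (2 : ℝ) • r ⊗ₜ entryRe i j + h ⊗ₜ entryRe j j) (x ⊗ₜ A) =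
      (entryRe i i A • g + (2 * entryRe i j A) • r + entryRe j j A • h) x := by
    simp only [map_add, map_smul, LinearMap.add_apply, LinearMap.smul_apply,
      TensorProduct.dualDistrib_apply, smul_eq_mul]
    ring
  simp only [hlin]
  refine nonneg_of_mem_hull (fun e he => ?_) hx
  simp only [LinearMap.add_apply, LinearMap.smul_apply, smul_eq_mul]
  have := pairing_nonneg (b := 2 * r e) hA1 hA2 (hg e he) (hh e he) hA3 ?_
  · linarith
  · rcases hr e he with ⟨h1, h2⟩ | h0
    · have := mul_le_mul h1 h2 (abs_nonneg _) (hg e he)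
      rw [← sq, sq_abs] at this
      linarith
    · have := mul_nonneg (hg e he) (hh e he)
      rw [h0]
      linarith

theorem mem_span_of_isNuclear {n : ℕ} (hn : 2 ≤ n) {s : Set V} (hs : s.Finite)
    (hnuc : IsNuclear (PointedCone.hull ℝ s) (PSD n)) {a c t : V}
    (ha : a ∈ PointedCone.hull ℝ s) (hc : c ∈ PointedCone.hull ℝ s)
    (ht : t ∈ PointedCone.hull ℝ s) (htac : InFace (PointedCone.hull ℝ s) (a + c) t) :
    t ∈ Submodule.span ℝ {e ∈ s | InFace (PointedCone.hull ℝ s) a e ∨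
      InFace (PointedCone.hull ℝ s) c e} := by
  by_contra hcon
  obtain ⟨r, hrt, hr⟩ := Submodule.exists_le_ker_of_notMem hcon
  obtain ⟨M, -, hM⟩ := htac
  let β : V → ℝ := fun e => |r e|
  obtain ⟨g, hg, hga, hgβ⟩ := exists_exposing hs ha β
  obtain ⟨h, hh, hhc, hhβ⟩ := exists_exposing hs hc β
  let i : Fin n := ⟨0, by omega⟩
  let j : Fin n := ⟨1, by omega⟩
  have hij : i ≠ j := by simp [i, j]
  have hr' : ∀ e ∈ s, |r e| ≤ g e ∧ |r e| ≤ h e ∨ r e = 0 := by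
    intro e he
    by_cases hf : InFace (PointedCone.hull ℝ s) a e ∨ InFace (PointedCone.hull ℝ s) c e
    · exact Or.inr (hr (Submodule.subset_span ⟨he, hf⟩))
    · push Not at hf
      exact Or.inl ⟨hgβ e he hf.1, hhβ e he hf.2⟩
  have key : ∀ ε : ℝ, 2 * (ε * r t) ≤ ε ^ 2 * (M ^ 2 * (g c + h a)) := by
    intro ε
    have hmem := blockTensor_mem_maxTensorProduct i j ha hc ht hM ε
    rw [← hnuc] at hmem
    have := dualDistrib_nonneg_of_mem_minTensorProduct i j hg hh hr' hmem
    -- Since `g a = 0` and `h c = 0`, the diagonal blocks contribute only at order `ε²`.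
    simp [blockTensor, outer, offDiag, Matrix.vecMulVec_apply, hij, hij.symm, hga, hhc] at this
    linarith
  set K := M ^ 2 * (g c + h a)
  -- This `ε` has the sign of `r t` and is small enough for the linear term to beat the quadratic
  -- one.
  have h1 := key (r t / (|K| + 1))
  have hK : 0 < |K| + 1 := by positivity
  have h2 : 0 < r t ^ 2 := by positivity
  have h3 : 2 * (r t / (|K| + 1) * r t) = 2 * (r t ^ 2 / (|K| + 1)) := by ring
  have h4 : (r t / (|K| + 1)) ^ 2 * K ≤ r t ^ 2 / (|K| + 1) := by
    rw [div_pow, div_mul_eq_mul_div, div_le_div_iff₀ (by positivity) hK]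
    have : K ≤ |K| + 1 := by linarith [le_abs_self K]
    nlinarith [mul_le_mul_of_nonneg_left this (mul_pos h2 hK).le]
  have h5 : 0 < r t ^ 2 / (|K| + 1) := by positivity
  linarith

/-! ### From the span condition to linear independence -/

theorem inFace_sum_filter_pos {C : PointedCone ℝ V} (S : Finset V) (hS : ∀ x ∈ S, x ∈ C)
    (α : V → ℝ) : InFace C (∑ x ∈ S with 0 < α x, x) (∑ x ∈ S, α x • x) := by
  refine ⟨∑ x ∈ S with 0 < α x, α x, Finset.sum_nonneg fun x hx => (Finset.mem_filter.1 hx).2.le, ?_⟩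
  rw [← Finset.sum_filter_add_sum_filter_not S (fun x => 0 < α x) (fun x => α x • x),
    ← sub_sub, Finset.smul_sum, ← Finset.sum_sub_distrib, sub_eq_add_neg, ← Finset.sum_neg_distrib]
  refine add_mem (sum_mem fun x hx => ?_) (sum_mem fun x hx => ?_)
  · rw [← sub_smul]
    exact C.smul_mem (sub_nonneg.2 (Finset.single_le_sum (f := α)
      (fun y hy => (Finset.mem_filter.1 hy).2.le) hx)) (hS x (Finset.mem_filter.1 hx).1)
  · rw [← neg_smul]
    exact C.smul_mem (neg_nonneg.2 (not_lt.1 (Finset.mem_filter.1 hx).2))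
      (hS x (Finset.mem_filter.1 hx).1)

/-- In a salient cone, an irredundant generator spans an extreme ray. -/
theorem eq_of_inFace_generator {E : Set V}
    (hsal : ∀ x, x ∈ PointedCone.hull ℝ E → -x ∈ PointedCone.hull ℝ E → x = 0)
    (hirr : ∀ e ∈ E, e ∉ PointedCone.hull ℝ (E \ {e})) {y w : V} (hy : y ∈ E) (hw : w ∈ E)
    (hyw : InFace (PointedCone.hull ℝ E) y w) : w = y := by
  by_contra hne
  obtain ⟨M, -, hM⟩ := hyw
  rw [← Set.insert_sdiff_self_of_mem hy] at hM
  obtain ⟨⟨c, hc⟩, z, hz, hcz⟩ := Submodule.mem_span_insert.1 hM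
  rw [Nonneg.mk_smul] at hcz
  have hw' : w ∈ PointedCone.hull ℝ (E \ {y}) := Submodule.subset_span ⟨hw, hne⟩
  have hmono : PointedCone.hull ℝ (E \ {y}) ≤ PointedCone.hull ℝ E :=
    Submodule.span_mono Set.sdiff_subset
  have heq : (M - c) • y = w + z := by
    rw [sub_smul, sub_eq_iff_eq_add, sub_eq_iff_eq_add.1 hcz]
    abel
  -- A positive coefficient makes `y` redundant; otherwise `-w` is in the cone and salience gives `w
  -- = 0`.
  rcases lt_or_ge 0 (M - c) with hpos | hneg
  · refine hirr y hy ?_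
    have := PointedCone.smul_mem _ (inv_nonneg.2 hpos.le) (add_mem hw' hz)
    rwa [← heq, inv_smul_smul₀ hpos.ne'] at this
  · have h0 : w = 0 := by
      refine hsal w (hmono hw') ?_
      have : -w = z + (-(M - c)) • y := by
        rw [neg_smul, heq]
        abel
      rw [this]
      exact add_mem (hmono hz)
        (PointedCone.smul_mem _ (neg_nonneg.2 hneg) (Submodule.subset_span hy))
    exact hirr w hw (h0 ▸ zero_mem _)

/-- If the faces of a cone satisfy the dimension condition `hspan`, then every set of irredundant
generators is the set of all generators in the face it generates. -/
theorem mem_of_inFace_sum {E : Set V}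
    (hsal : ∀ x, x ∈ PointedCone.hull ℝ E → -x ∈ PointedCone.hull ℝ E → x = 0)
    (hirr : ∀ e ∈ E, e ∉ PointedCone.hull ℝ (E \ {e}))
    (hspan : ∀ a ∈ PointedCone.hull ℝ E, ∀ c ∈ PointedCone.hull ℝ E, ∀ t ∈ PointedCone.hull ℝ E,
      InFace (PointedCone.hull ℝ E) (a + c) t →
      t ∈ Submodule.span ℝ {e ∈ E | InFace (PointedCone.hull ℝ E) a e ∨
        InFace (PointedCone.hull ℝ E) c e})
    (S : Finset V) : (S : Set V) ⊆ E → ∀ w ∈ E,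
      InFace (PointedCone.hull ℝ E) (∑ x ∈ S, x) w → w ∈ S := by
  classical
  induction S using Finset.strongInduction with
  | H S ih =>
    intro hSE w hw hwS
    have hSC : ∀ x ∈ S, x ∈ PointedCone.hull ℝ E := fun x hx => Submodule.subset_span (hSE hx)
    have hwC : w ∈ PointedCone.hull ℝ E := Submodule.subset_span hw
    rcases S.eq_empty_or_nonempty with rfl | ⟨y, hy⟩
    · obtain ⟨M, -, hM⟩ := hwS
      have h0 : w = 0 := hsal w hwC (by simpa using hM)
      exact absurd (h0 ▸ zero_mem _) (hirr w hw)
    have hspanS : w ∈ Submodule.span ℝ (S : Set V) := by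
      -- Split off `y`: by induction the face of the remaining sum contributes only elements of `S`,
      -- and the ray of `y` only `y`.
      rw [← Finset.sum_erase_add _ _ hy] at hwS
      refine Submodule.span_mono ?_ (hspan _ (sum_mem fun x hx => hSC x (Finset.mem_of_mem_erase hx))
        y (hSC y hy) w hwC hwS)
      rintro e ⟨he, h | h⟩
      · exact Finset.mem_of_mem_erase (ih _ (Finset.erase_ssubset hy)
          ((Finset.coe_subset.2 (Finset.erase_subset _ _)).trans hSE) e he h)
      · rw [eq_of_inFace_generator hsal hirr (hSE hy) he h]
        exact hy
    obtain ⟨α, -, rfl⟩ := Submodule.mem_span_finset.1 hspanS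
    by_contra hwS'
    -- All coefficients positive contradicts irredundancy; otherwise the positive part is a strictly
    -- smaller set whose face contains `w`.
    by_cases hα : ∀ x ∈ S, 0 < α x
    · refine hirr _ hw (sum_mem fun x hx => PointedCone.smul_mem _ (hα x hx).le
        (Submodule.subset_span ⟨hSE hx, ?_⟩))
      rintro rfl
      exact hwS' hx
    · push Not at hα
      obtain ⟨x, hx, hxα⟩ := hα
      have hss : S.filter (fun x => 0 < α x) ⊂ S :=
        Finset.filter_ssubset.2 ⟨x, hx, not_lt.2 hxα⟩
      exact hwS' (hss.1 (ih _ hss ((Finset.coe_subset.2 hss.1).trans hSE) _ hw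
        (inFace_sum_filter_pos S hSC α)))

theorem exists_irredundant_generators {s : Set V} (hs : s.Finite) :
    ∃ E : Set V, E.Finite ∧ PointedCone.hull ℝ E = PointedCone.hull ℝ s ∧
      ∀ e ∈ E, e ∉ PointedCone.hull ℝ (E \ {e}) := by
  have hfin : {E : Set V | E ⊆ s ∧ PointedCone.hull ℝ E = PointedCone.hull ℝ s}.Finite :=
    hs.finite_subsets.subset fun E hE => hE.1
  obtain ⟨E, hE⟩ := hfin.exists_minimal ⟨s, subset_rfl, rfl⟩
  refine ⟨E, hs.subset hE.prop.1, hE.prop.2, fun e he hmem => ?_⟩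
  have hle : PointedCone.hull ℝ E ≤ PointedCone.hull ℝ (E \ {e}) := by
    refine Submodule.span_le.2 fun x hx => ?_
    by_cases hxe : x = e
    · rwa [hxe]
    · exact Submodule.subset_span ⟨hx, hxe⟩
  have := hE.le_of_le (y := E \ {e}) ⟨Set.sdiff_subset.trans hE.prop.1,
    (le_antisymm (Submodule.span_mono Set.sdiff_subset) hle).trans hE.prop.2⟩ Set.sdiff_subset
  exact (this he).2 rfl

theorem isSimplicial_of_isNuclear {C : PointedCone ℝ V} (hsal : ∀ x, x ∈ C → -x ∈ C → x = 0)
    (hpoly : IsPolyhedral C) {n : ℕ} (hn : 2 ≤ n) (hnuc : IsNuclear C (PSD n)) :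
    C.IsSimplicial := by
  classical
  obtain ⟨s, hs, rfl⟩ := hpoly
  obtain ⟨E, hE, hEs, hirr⟩ := exists_irredundant_generators hs
  rw [← hEs] at hsal hnuc ⊢
  refine ⟨E, hE, linearIndepOn_iff_notMem_span.2 fun w hw hmem => ?_, rfl⟩
  rw [Set.image_id, id] at hmem
  lift E to Finset V using hE
  rw [← Finset.coe_erase] at hmem
  obtain ⟨α, -, hα⟩ := Submodule.mem_span_finset.1 hmem
  -- In a relation `w = ∑ α x • x`, the generators with positive coefficient already have `w` in
  -- their face, yet `w` is not among them.
  have hsub : ((E.erase w).filter fun x => 0 < α x : Set V) ⊆ E := fun x hx =>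
    Finset.mem_of_mem_erase (Finset.mem_filter.1 hx).1
  have hface := inFace_sum_filter_pos (C := PointedCone.hull ℝ (E : Set V)) (E.erase w)
    (fun x hx => Submodule.subset_span (Finset.mem_of_mem_erase hx)) α
  rw [hα] at hface
  have := mem_of_inFace_sum hsal hirr (fun a ha c hc t ht h =>
    mem_span_of_isNuclear hn E.finite_toSet hnuc ha hc ht h) _ hsub w hw hface
  simp at this

/-! ### Classical cones as simplicial cones, and the converse -/

theorem image_equivFun_hull_range {ι : Type*} [Fintype ι] (b : Module.Basis ι ℝ V) :
    b.equivFun '' (PointedCone.hull ℝ (Set.range b) : Set V) =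
      (PointedCone.positive ℝ (ι → ℝ) : Set (ι → ℝ)) := by
  classical
  ext y
  constructor
  · rintro ⟨x, hx, rfl⟩ i
    refine nonneg_of_mem_hull (f := b.coord i) ?_ hx
    rintro _ ⟨j, rfl⟩
    simp only [Module.Basis.coord_apply, Module.Basis.repr_self, Finsupp.single_apply]
    split_ifs <;> simp
  · intro hy
    refine ⟨b.equivFun.symm y, ?_, b.equivFun.apply_symm_apply y⟩
    rw [Module.Basis.equivFun_symm_apply]
    exact sum_mem fun i _ => PointedCone.smul_mem _ (hy i) (Submodule.subset_span ⟨i, rfl⟩)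

theorem isClassical_iff_exists_basis {C : PointedCone ℝ V} :
    IsClassical C ↔ ∃ m : ℕ, 1 ≤ m ∧ ∃ b : Module.Basis (Fin m) ℝ V,
      PointedCone.hull ℝ (Set.range b) = C := by
  constructor
  · rintro ⟨m, hm, Φ, hΦ⟩
    refine ⟨m, hm, Module.Basis.ofEquivFun Φ, SetLike.coe_injective ?_⟩
    refine Φ.injective.image_injective ?_
    rw [hΦ, ← image_equivFun_hull_range (Module.Basis.ofEquivFun Φ)]
    simp
  · rintro ⟨m, hm, b, rfl⟩
    exact ⟨m, hm, b.equivFun, image_equivFun_hull_range b⟩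

theorem isClassical_iff_isSimplicial [Nontrivial V] {C : PointedCone ℝ V}
    (hgen : Submodule.span ℝ (C : Set V) = ⊤) : IsClassical C ↔ C.IsSimplicial := by
  rw [isClassical_iff_exists_basis]
  constructor
  · rintro ⟨m, -, b, rfl⟩
    exact ⟨Set.range b, Set.finite_range b, b.linearIndependent.linearIndepOn_id, rfl⟩
  · rintro ⟨s, hs, hli, rfl⟩
    have := hs.fintype
    have hspan : Submodule.span ℝ s = ⊤ := by
      refine top_unique (hgen ▸ Submodule.span_le.2 ?_)
      exact PointedCone.hull_le_span ℝ s
    let b : Module.Basis s ℝ V := Module.Basis.mk hli (by simp [hspan])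
    let b' := b.reindex (Fintype.equivFin s)
    refine ⟨Fintype.card s, Fintype.card_pos_iff.2 b.index_nonempty, b', ?_⟩
    simp [b', b]

theorem isClosed_PSD (n : ℕ) : IsClosed (PSD n : Set (Herm n)) := by
  have : (PSD n : Set (Herm n)) = ⋂ x : Fin n → ℂ, {A : Herm n |
      0 ≤ star x ⬝ᵥ ((A : Matrix (Fin n) (Fin n) ℂ).mulVec x)} := by
    ext A
    simp only [SetLike.mem_coe, mem_PSD, Matrix.posSemidef_iff_dotProduct_mulVec, Set.mem_iInter,
      Set.mem_ofPred_eq, and_iff_right_iff_imp]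
    exact fun _ => A.2
  rw [this]
  refine isClosed_iInter fun x => isClosed_le continuous_const ?_
  fun_prop

theorem isNuclear_PSD_of_isSimplicial {C : PointedCone ℝ V}
    (hgen : Submodule.span ℝ (C : Set V) = ⊤) (hC : C.IsSimplicial) (n : ℕ) :
    IsNuclear C (PSD n) := by
  let F := selfAdjoint.submodule ℝ (Matrix (Fin n) (Fin n) ℂ)
  have : FiniteDimensional ℝ (Herm n) := inferInstanceAs (FiniteDimensional ℝ F)
  have : LocallyConvexSpace ℝ (Matrix (Fin n) (Fin n) ℂ) :=
    inferInstanceAs (LocallyConvexSpace ℝ (Fin n → Fin n → ℂ))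
  have : LocallyConvexSpace ℝ (Herm n) := LocallyConvexSpace.induced F.subtype
  have : ContinuousSMul ℝ (Herm n) := inferInstanceAs (ContinuousSMul ℝ F)
  exact PointedCone.minTensorProduct_eq_max_of_simplicial_generating_left C
    ⟨PSD n, isClosed_PSD n⟩ hC hgen

end

end ConeTensor

theorem theorem3 {V : Type*} [AddCommGroup V] [Module ℝ V] [FiniteDimensional ℝ V] [Nontrivial V]
    [TopologicalSpace V] [IsTopologicalAddGroup V] [ContinuousSMul ℝ V] [T2Space V]
    (C : PointedCone ℝ V) (hC : ConeTensor.IsProper C) (hpoly : ConeTensor.IsPolyhedral C)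
    (n : ℕ) (hn : 2 ≤ n) :
    ConeTensor.IsNuclear C (ConeTensor.PSD n) ↔ ConeTensor.IsClassical C := by
  rw [ConeTensor.isClassical_iff_isSimplicial hC.generating]
  exact ⟨ConeTensor.isSimplicial_of_isNuclear hC.salient hpoly hn,
    fun h => ConeTensor.isNuclear_PSD_of_isSimplicial hC.generating h n⟩
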